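/- Let $\phi:\mathbb{R}\to\mathbb{C}$ be Riemann's non-differentiable function \[ \phi(t)=\sum_{k\in\mathbb{Z}}\frac{e^{-4\pi^2 i k^2 t}-1}{-4\pi^2k^2}, \] where the term $k=0$ is understood as its limit $it$, and for integers $p\ge 0$, $q\ge 1$ put $t_{p,q}=\frac{p/q}{2\pi}$. Let $M>0$. Then there exists a constant $C_M>0$, depending only on $M$ (in particular independent of $p$, $q$ and $h$), such that for all integers $p\ge 0$, $q\ge 1$ with $\gcd(p,q)=1$ and $q\equiv 0,1,3 \pmod 4$, \[ \left|\phi(t_{p,q}+h)-\phi(t_{p,q})\right|\le C_M\,\frac{|h|^{1/2}}{q^{1/2}} \qquad\text{for all real } h \text{ with } |h|<\frac{M}{q^2}. \] -/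

import Mathlib

/-- The `k`-th term of Riemann's function,
`(exp (-4 π² i k² t) - 1) / (-4 π² k²)`; for `k = 0` the quotient is understood as its limit
as `k → 0`, which is `i t`. -/
noncomputable def riemannTerm (t : ℝ) (k : ℤ) : ℂ :=
  if k = 0 then Complex.I * (t : ℂ)
  else (Complex.exp (-4 * (Real.pi : ℂ) ^ 2 * Complex.I * (k : ℂ) ^ 2 * (t : ℂ)) - 1) /
    (-4 * (Real.pi : ℂ) ^ 2 * (k : ℂ) ^ 2)

/-- Riemann's non-differentiable function, in its complex-valued geometric version
`φ(t) = ∑_{k ∈ ℤ} (exp (-4 π² i k² t) - 1) / (-4 π² k²)`. -/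
noncomputable def riemannPhi (t : ℝ) : ℂ := ∑' k : ℤ, riemannTerm t k

/-- The series defining `riemannPhi` converges absolutely, so its value is never a default one. -/
theorem summable_riemannTerm (t : ℝ) : Summable (riemannTerm t) := by
  have hs : Summable (fun k : ℤ => 2 * (1 / (k : ℝ) ^ 2)) :=
    (Real.summable_one_div_int_pow.mpr one_lt_two).mul_left 2
  refine Summable.of_norm_bounded_eventually hs ?_
  have hf : {k : ℤ | ¬ ‖riemannTerm t k‖ ≤ 2 * (1 / (k : ℝ) ^ 2)} ⊆ {0} := by
    intro k hk
    by_contra h0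
    apply hk
    have hk0 : k ≠ 0 := h0
    have hkr : (0 : ℝ) < (k : ℝ) ^ 2 := by positivity
    have hpi : (1 : ℝ) ≤ 4 * Real.pi ^ 2 := by nlinarith [Real.pi_gt_three]
    have he : ‖Complex.exp (-4 * (Real.pi : ℂ) ^ 2 * Complex.I * (k : ℂ) ^ 2 * (t : ℂ))‖ = 1 := by
      have : (-4 * (Real.pi : ℂ) ^ 2 * Complex.I * (k : ℂ) ^ 2 * (t : ℂ)) =
          ((-4 * Real.pi ^ 2 * (k : ℝ) ^ 2 * t : ℝ) : ℂ) * Complex.I := by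
        push_cast
        ring
      rw [this, Complex.norm_exp_ofReal_mul_I]
    have hn : ‖Complex.exp (-4 * (Real.pi : ℂ) ^ 2 * Complex.I * (k : ℂ) ^ 2 * (t : ℂ)) - 1‖ ≤ 2 := by
      refine (norm_sub_le _ _).trans ?_
      rw [he, norm_one]
      norm_num
    have hd : ‖(-4 * (Real.pi : ℂ) ^ 2 * (k : ℂ) ^ 2)‖ = 4 * Real.pi ^ 2 * (k : ℝ) ^ 2 := by
      have : (-4 * (Real.pi : ℂ) ^ 2 * (k : ℂ) ^ 2) =
          ((-(4 * Real.pi ^ 2 * (k : ℝ) ^ 2) : ℝ) : ℂ) := by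
        push_cast
        ring
      rw [this, Complex.norm_real, norm_neg, Real.norm_of_nonneg (by positivity)]
    rw [riemannTerm, if_neg hk0, norm_div, hd, mul_one_div]
    exact div_le_div₀ (by norm_num) hn hkr (by nlinarith)
  exact (Set.finite_singleton (0 : ℤ)).subset hf

/-- The rational point `t_{p,q} = (p / q) / (2 π)`. -/
noncomputable def ratPoint (p q : ℕ) : ℝ := ((p : ℝ) / (q : ℝ)) / (2 * Real.pi)

/-!
Put `Φ(z) = ∑ k, e(-p k² / q) (exp(-4π² k² z) - 1) / (-4π² k²)` for `0 ≤ re z`, where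
`e(x) = exp(2π i x)` and the term `k = 0` is `z`. Then
`φ(t_{p,q} + h) - φ(t_{p,q}) = Φ(i h)` (`riemannPhi_sub_eq`), and inside the half-plane `Φ'` is the
twisted theta series `∑ k, e(-p k² / q) exp(-4π² k² z)`.

Summing over residue classes modulo `q` and applying the Poisson formula for Gaussians
(`tsum_twisted_theta`) gives, with `A n = n² / (4 q²)` and quadratic Gauss sums `G n`,
`Φ'(z) = (2 q √π)⁻¹ ∑ n, G n * z ^ (-1/2) * exp(-A n / z)`. The Gauss sums satisfy
`|G n| ≤ √(2 q)` for every `q` (`norm_quadGaussSum_le`), and `|exp(-A n / z)| ≤ 1`.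

The term `n = 0` has the primitive `2 z ^ (1/2)`, which yields the claimed size
`|h| ^ (1/2) / q ^ (1/2)`. For `n ≠ 0` the oscillation is exploited by comparing with
`z ^ (3/2) / A n * exp(-A n / z)`, whose derivative is the term itself plus an error
`(3/2) z ^ (1/2) / A n * exp(-A n / z)`. Both are summable in `n` because `1 / A n = 4 q² / n²`, and
each contributes at most a constant times `(q² |h|) |h| ^ (1/2) / q ^ (1/2)`, where
`q² |h| < M`. The mean value inequality turns the bound on the error terms into a bound for `Φ`
between `ε` and `ε + i h` (`norm_tsum_thetaPrimitive_sub_le`), and `ε → 0⁺` gives the theorem, since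
`Φ` is continuous up to the boundary and `Φ(0) = 0`.
-/

/-! ### Quadratic Gauss sums -/

/-- The quadratic Gauss sum `∑ r mod q, e((a r² + b r) / q)`. -/
noncomputable def quadGaussSum {q : ℕ} [NeZero q] (a b : ZMod q) : ℂ :=
  ∑ r : ZMod q, ZMod.stdAddChar (a * r ^ 2 + b * r)

theorem ZMod.norm_stdAddChar {q : ℕ} [NeZero q] (x : ZMod q) :
    ‖(ZMod.stdAddChar x : ℂ)‖ = 1 := by
  rw [ZMod.stdAddChar_apply, Circle.norm_coe]

theorem ZMod.card_two_mul_eq_zero_le (q : ℕ) [NeZero q] :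
    (Finset.univ.filter fun u : ZMod q => 2 * u = 0).card ≤ 2 := by
  classical
  simpa [two_nsmul, two_mul] using IsAddCyclic.card_nsmul_eq_zero_le (α := ZMod q) two_pos

/-- In `|G|² = ∑ r, ∑ s, e((f r - f s) / q)` the substitution `r = s + u` makes the phase linear in
`s` with slope `2 a u`; only the at most two `u` with `2 u = 0` contribute. -/
theorem norm_quadGaussSum_le {q : ℕ} [NeZero q] {a : ZMod q} (ha : IsUnit a) (b : ZMod q) :
    ‖quadGaussSum a b‖ ≤ √(2 * q) := by
  classical
  apply Real.le_sqrt_of_sq_le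
  have hconj : (starRingEnd ℂ) (quadGaussSum a b) =
      ∑ s : ZMod q, ZMod.stdAddChar (-(a * s ^ 2 + b * s)) := by
    simp only [quadGaussSum, map_sum, ← AddChar.map_neg_eq_conj]
  have hsq : quadGaussSum a b * (starRingEnd ℂ) (quadGaussSum a b) =
      ∑ u : ZMod q, ZMod.stdAddChar (a * u ^ 2 + b * u) *
        (if 2 * u = 0 then (q : ℂ) else 0) := by
    rw [hconj, quadGaussSum, Finset.sum_mul_sum, Finset.sum_comm]
    have h1 : ∀ s : ZMod q, ∑ r : ZMod q, (ZMod.stdAddChar (a * r ^ 2 + b * r) : ℂ) *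
        ZMod.stdAddChar (-(a * s ^ 2 + b * s)) =
        ∑ u : ZMod q, ZMod.stdAddChar (a * u ^ 2 + b * u) *
          ZMod.stdAddChar (s * (a * (2 * u))) := by
      intro s
      rw [← Equiv.sum_comp (Equiv.addRight s)]
      refine Finset.sum_congr rfl fun u _ => ?_
      rw [← AddChar.map_add_eq_mul, ← AddChar.map_add_eq_mul, Equiv.coe_addRight]
      congr 1
      ring
    simp_rw [h1]
    rw [Finset.sum_comm]
    refine Finset.sum_congr rfl fun u _ => ?_
    rw [← Finset.mul_sum, AddChar.sum_mulShift _ (ZMod.isPrimitive_stdAddChar q), ZMod.card]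
    simp [ha.mul_right_eq_zero]
  calc ‖quadGaussSum a b‖ ^ 2
      = ‖quadGaussSum a b * (starRingEnd ℂ) (quadGaussSum a b)‖ := by
        rw [norm_mul, RCLike.norm_conj, sq]
    _ ≤ ∑ u : ZMod q, (if 2 * u = 0 then (q : ℝ) else 0) := by
        rw [hsq]
        refine norm_sum_le_of_le _ fun u _ => ?_
        rw [norm_mul, ZMod.norm_stdAddChar, one_mul]
        split_ifs <;> simp
    _ = (Finset.univ.filter fun u : ZMod q => 2 * u = 0).card * (q : ℝ) := by
        rw [← Finset.sum_filter, Finset.sum_const, nsmul_eq_mul]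
    _ ≤ 2 * q := by
        gcongr
        exact_mod_cast ZMod.card_two_mul_eq_zero_le q

/-! ### Transformation of the twisted theta series -/

theorem Fin.sum_natCast_zmod {q : ℕ} [NeZero q] (f : ZMod q → ℂ) :
    ∑ r : Fin q, f ((r : ℕ) : ZMod q) = ∑ x : ZMod q, f x := by
  refine Fintype.sum_equiv (ZMod.finEquiv q).toEquiv _ _ fun r => ?_
  congr 1
  obtain _ | q := q
  · exact absurd rfl (NeZero.ne 0)
  · exact Fin.cast_val_eq_self r

theorem re_inv_pos {z : ℂ} (hz : 0 < z.re) : 0 < (z⁻¹).re := by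
  have : z ≠ 0 := by rintro rfl; simp at hz
  rw [Complex.inv_re]
  exact div_pos hz (Complex.normSq_pos.mpr this)

theorem norm_exp_neg_div_le_one {A : ℝ} (hA : 0 ≤ A) {z : ℂ} (hz : 0 < z.re) :
    ‖Complex.exp (-(A / z))‖ ≤ 1 := by
  rw [Complex.norm_exp, Real.exp_le_one_iff, div_eq_mul_inv, Complex.neg_re, Complex.re_ofReal_mul]
  have := re_inv_pos hz
  nlinarith [mul_nonneg hA this.le]

theorem summable_exp_neg_mul_sq {w : ℂ} (hw : 0 < w.re) :
    Summable fun n : ℤ => Complex.exp (-(w * (n : ℂ) ^ 2)) := by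
  have h := (hasSum_jacobiTheta₂_term 0 (τ := Complex.I * (w / Real.pi)) (by
    simp [Complex.div_ofReal_re]; positivity)).summable
  refine h.congr fun n => ?_
  rw [jacobiTheta₂_term]
  congr 1
  have : (Real.pi : ℂ) ≠ 0 := by exact_mod_cast Real.pi_ne_zero
  field_simp
  ring_nf
  simp

/-- The summation over one residue class `r` modulo `q`: the Poisson formula for a Gaussian. -/
theorem tsum_exp_residue {q : ℕ} [NeZero q] (r : ℕ) {z : ℂ} (hz : 0 < z.re) :
    ∑' m : ℤ, Complex.exp (-(4 * Real.pi ^ 2 * ((m * q + r : ℤ) : ℂ) ^ 2 * z)) =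
      (2 * q * √Real.pi : ℝ)⁻¹ * (z ^ (1 / 2 : ℂ))⁻¹ *
        ∑' n : ℤ, ZMod.stdAddChar (-(n : ZMod q) * (r : ZMod q)) *
          Complex.exp (-(((n : ℝ) ^ 2 / (4 * q ^ 2) : ℝ) / z)) := by
  have hz0 : z ≠ 0 := by rintro rfl; simp at hz
  have hq0 : (q : ℂ) ≠ 0 := by exact_mod_cast NeZero.ne q
  have hqpos : (0 : ℝ) < q := by exact_mod_cast Nat.pos_of_neZero q
  have hpi : (Real.pi : ℂ) ≠ 0 := by exact_mod_cast Real.pi_ne_zero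
  have hpip := Real.pi_pos
  have hs0 : z ^ (1 / 2 : ℂ) ≠ 0 := by simp [Complex.cpow_eq_zero_iff, hz0]
  set κ : ℝ := (4 * Real.pi * q ^ 2)⁻¹ with hκ
  have hκpos : 0 < κ := by positivity
  set α : ℂ := κ * z⁻¹ with hα
  have hαre : 0 < α.re := by
    rw [hα, Complex.re_ofReal_mul]
    exact mul_pos hκpos (re_inv_pos hz)
  have hα0 : α ≠ 0 := by intro h; simp [h] at hαre
  have hκs : (κ : ℂ) ^ (1 / 2 : ℂ) = ((2 * q * √Real.pi)⁻¹ : ℝ) := by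
    rw [show (1 / 2 : ℂ) = ((1 / 2 : ℝ) : ℂ) by push_cast; ring,
      ← Complex.ofReal_cpow hκpos.le, ← Real.sqrt_eq_rpow]
    congr 1
    rw [Real.sqrt_eq_iff_mul_self_eq hκpos.le (by positivity), hκ, ← mul_inv]
    congr 1
    nlinarith [Real.mul_self_sqrt hpip.le]
  have harg : z.arg ≠ Real.pi := Complex.slitPlane_arg_ne_pi (Or.inl hz)
  have hαs : α ^ (1 / 2 : ℂ) = (2 * q * √Real.pi : ℝ)⁻¹ * (z ^ (1 / 2 : ℂ))⁻¹ := by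
    -- the principal branch splits the power because `κ` is a positive real
    have hmul : α ^ (1 / 2 : ℂ) = (κ : ℂ) ^ (1 / 2 : ℂ) * (z⁻¹) ^ (1 / 2 : ℂ) := by
      have hκ0 : (κ : ℂ) ≠ 0 := by exact_mod_cast hκpos.ne'
      rw [hα, Complex.cpow_def_of_ne_zero (mul_ne_zero hκ0 (inv_ne_zero hz0)),
        Complex.cpow_def_of_ne_zero hκ0, Complex.cpow_def_of_ne_zero (inv_ne_zero hz0),
        Complex.log_ofReal_mul hκpos (inv_ne_zero hz0), ← Complex.exp_add,
        ← Complex.ofReal_log hκpos.le, add_mul]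
    rw [hmul, hκs, Complex.inv_cpow _ _ harg]
  -- the choice `b = -i r / q` turns `n + i b` into `n + r / q`
  have key := Complex.tsum_exp_neg_quadratic hαre (-(Complex.I * (r / q)))
  have hαs0 : α ^ (1 / 2 : ℂ) ≠ 0 := by simp [Complex.cpow_eq_zero_iff, hα0]
  rw [one_div, eq_inv_mul_iff_mul_eq₀ hαs0] at key
  rw [← hαs]
  refine (Eq.trans ?_ key.symm).trans ?_
  · refine tsum_congr fun m => ?_
    congr 1
    rw [hα, hκ]
    push_cast
    rw [show (m : ℂ) + Complex.I * -(Complex.I * (r / q)) = m + r / q by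
      linear_combination (-(r / q : ℂ)) * Complex.I_mul_I]
    field_simp
  · congr 1
    refine tsum_congr fun n => ?_
    rw [show -(n : ZMod q) * (r : ZMod q) = ((-n * r : ℤ) : ZMod q) by push_cast; ring,
      ZMod.stdAddChar_coe, ← Complex.exp_add]
    congr 1
    rw [hα, hκ]
    push_cast
    field_simp
    ring

/-- The modular transformation of the theta series `∑ k, e(a k² / q) exp(-4π² k² z)`: grouping the
`k` by their residues modulo `q`, the dual series acquires quadratic Gauss sums as coefficients. -/
theorem tsum_twisted_theta {q : ℕ} [NeZero q] (a : ZMod q) {z : ℂ} (hz : 0 < z.re) :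
    ∑' k : ℤ, ZMod.stdAddChar (a * (k : ZMod q) ^ 2) *
        Complex.exp (-(4 * Real.pi ^ 2 * (k : ℂ) ^ 2 * z)) =
      (2 * q * √Real.pi : ℝ)⁻¹ * (z ^ (1 / 2 : ℂ))⁻¹ *
        ∑' n : ℤ, quadGaussSum a (-(n : ZMod q)) *
          Complex.exp (-(((n : ℝ) ^ 2 / (4 * q ^ 2) : ℝ) / z)) := by
  have hqpos : (0 : ℝ) < q := by exact_mod_cast Nat.pos_of_neZero q
  have hpip := Real.pi_pos
  have hs1 : Summable fun k : ℤ => (ZMod.stdAddChar (a * (k : ZMod q) ^ 2) : ℂ) *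
        Complex.exp (-(4 * Real.pi ^ 2 * (k : ℂ) ^ 2 * z)) := by
    have hw : 0 < ((4 * Real.pi ^ 2 : ℝ) * z : ℂ).re := by
      rw [Complex.re_ofReal_mul]; positivity
    refine Summable.of_norm_bounded (summable_exp_neg_mul_sq hw).norm fun k => ?_
    rw [norm_mul, ZMod.norm_stdAddChar, one_mul]
    apply le_of_eq
    congr 2
    push_cast
    ring
  have hs2 : ∀ r : ZMod q, Summable fun n : ℤ =>
      (ZMod.stdAddChar (a * r ^ 2) : ℂ) * (ZMod.stdAddChar (-(n : ZMod q) * r) *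
          Complex.exp (-(((n : ℝ) ^ 2 / (4 * q ^ 2) : ℝ) / z))) := by
    intro r
    have hw : 0 < (((4 * q ^ 2)⁻¹ : ℝ) * z⁻¹ : ℂ).re := by
      rw [Complex.re_ofReal_mul]
      have := re_inv_pos hz
      positivity
    refine Summable.of_norm_bounded (summable_exp_neg_mul_sq hw).norm fun n => ?_
    rw [norm_mul, norm_mul, ZMod.norm_stdAddChar, ZMod.norm_stdAddChar, one_mul, one_mul]
    apply le_of_eq
    congr 2
    push_cast
    ring
  have hs1' := (Int.divModEquiv q).symm.summable_iff.mpr hs1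
  rw [← (Int.divModEquiv q).symm.tsum_eq, ← (Equiv.prodComm (Fin q) ℤ).tsum_eq]
  refine (Summable.tsum_prod ((Equiv.prodComm (Fin q) ℤ).summable_iff.mpr hs1')).trans ?_
  rw [tsum_fintype]
  have hres : ∀ r : Fin q, ∑' m : ℤ,
      ZMod.stdAddChar (a * (((Int.divModEquiv q).symm (m, r) : ℤ) : ZMod q) ^ 2) *
        Complex.exp (-(4 * Real.pi ^ 2 * (((Int.divModEquiv q).symm (m, r) : ℤ) : ℂ) ^ 2 * z)) =
      (2 * q * √Real.pi : ℝ)⁻¹ * (z ^ (1 / 2 : ℂ))⁻¹ * ∑' n : ℤ,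
        ZMod.stdAddChar (a * ((r : ℕ) : ZMod q) ^ 2) *
          (ZMod.stdAddChar (-(n : ZMod q) * ((r : ℕ) : ZMod q)) *
          Complex.exp (-(((n : ℝ) ^ 2 / (4 * q ^ 2) : ℝ) / z))) := by
    intro r
    rw [tsum_mul_left, mul_left_comm, ← tsum_exp_residue r hz, ← tsum_mul_left]
    refine tsum_congr fun m => ?_
    simp [Int.divModEquiv]
  refine (Finset.sum_congr rfl fun r _ => hres r).trans ?_
  rw [← Finset.mul_sum, Fin.sum_natCast_zmod fun x : ZMod q => ∑' n : ℤ,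
        ZMod.stdAddChar (a * x ^ 2) * (ZMod.stdAddChar (-(n : ZMod q) * x) *
          Complex.exp (-(((n : ℝ) ^ 2 / (4 * q ^ 2) : ℝ) / z))),
    ← Summable.tsum_finsetSum fun r _ => hs2 r]
  congr 1
  refine tsum_congr fun n => ?_
  rw [quadGaussSum, Finset.sum_mul]
  refine Finset.sum_congr rfl fun r _ => ?_
  rw [← mul_assoc, AddChar.map_add_eq_mul]

/-! ### The two families of primitives -/

/-- The `k`-th term of the holomorphic extension of `h ↦ φ(t + h) - φ(t)`, for a rational point `t`
with phases `e(a k² / q)`, to the half-plane `0 ≤ re z`; the real variable is `z = i h`. It is a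
primitive of the `k`-th term of a twisted theta series, and vanishes at `0`. -/
noncomputable def thetaPrimitive {q : ℕ} [NeZero q] (a : ZMod q) (k : ℤ) (z : ℂ) : ℂ :=
  ZMod.stdAddChar (a * (k : ZMod q) ^ 2) *
    if k = 0 then z
    else (Complex.exp (-(4 * Real.pi ^ 2 * (k : ℂ) ^ 2 * z)) - 1) /
      (-(4 * Real.pi ^ 2 * (k : ℂ) ^ 2))

/-- An approximate primitive of `z ^ (-1/2) * exp (-A / z)` with `A = n² / (4 q²)`, namely
`z ^ (3/2) / A * exp (-A / z)`, and `2 z ^ (1/2)` if `A = 0`. -/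
noncomputable def dualPrimitive (q : ℕ) (n : ℤ) (z : ℂ) : ℂ :=
  if n = 0 then 2 * z ^ (1 / 2 : ℂ)
  else z ^ (3 / 2 : ℂ) / ((n : ℝ) ^ 2 / (4 * q ^ 2) : ℝ) *
    Complex.exp (-(((n : ℝ) ^ 2 / (4 * q ^ 2) : ℝ) / z))

theorem summable_ite_add_mul_inv_sq (x y : ℝ) :
    Summable fun k : ℤ => (if k = 0 then x else 0) + y * (1 / (k : ℝ) ^ 2) :=
  (hasSum_ite_eq 0 x).summable.add ((Real.summable_one_div_int_pow.mpr one_lt_two).mul_left y)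

theorem tsum_ite_add_mul_inv_sq (x y : ℝ) :
    ∑' k : ℤ, ((if k = 0 then x else 0) + y * (1 / (k : ℝ) ^ 2)) =
      x + y * ∑' k : ℤ, 1 / (k : ℝ) ^ 2 := by
  rw [Summable.tsum_add (hasSum_ite_eq 0 x).summable
    ((Real.summable_one_div_int_pow.mpr one_lt_two).mul_left y), tsum_ite_eq, tsum_mul_left]

theorem norm_thetaPrimitive_le {q : ℕ} [NeZero q] (a : ZMod q) (k : ℤ) {z : ℂ} {R : ℝ}
    (hz : 0 ≤ z.re) (hR : ‖z‖ ≤ R) :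
    ‖thetaPrimitive a k z‖ ≤ (if k = 0 then R else 0) + 1 * (1 / (k : ℝ) ^ 2) := by
  rw [thetaPrimitive, norm_mul, ZMod.norm_stdAddChar, one_mul]
  split_ifs with hk
  · simpa [hk] using hR
  · have hkr : (0 : ℝ) < (k : ℝ) ^ 2 := by positivity
    have he : ‖Complex.exp (-(4 * Real.pi ^ 2 * (k : ℂ) ^ 2 * z))‖ ≤ 1 := by
      rw [Complex.norm_exp, Real.exp_le_one_iff, show -(4 * Real.pi ^ 2 * (k : ℂ) ^ 2 * z) =
        ((-(4 * Real.pi ^ 2 * (k : ℝ) ^ 2) : ℝ) : ℂ) * z by push_cast; ring, Complex.re_ofReal_mul]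
      have : 0 ≤ 4 * Real.pi ^ 2 * (k : ℝ) ^ 2 := by positivity
      nlinarith
    have hd : ‖-(4 * Real.pi ^ 2 * (k : ℂ) ^ 2)‖ = 4 * Real.pi ^ 2 * (k : ℝ) ^ 2 := by
      rw [norm_neg, show (4 * Real.pi ^ 2 * (k : ℂ) ^ 2) =
        ((4 * Real.pi ^ 2 * (k : ℝ) ^ 2 : ℝ) : ℂ) by push_cast; ring, Complex.norm_real,
        Real.norm_of_nonneg (by positivity)]
    rw [norm_div, hd, zero_add, one_mul, div_le_div_iff₀ (by positivity) hkr]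
    have h2 := (norm_sub_le (Complex.exp (-(4 * Real.pi ^ 2 * (k : ℂ) ^ 2 * z))) 1).trans
      (add_le_add_left he _)
    rw [norm_one] at h2
    have hpi : (2 : ℝ) ≤ 4 * Real.pi ^ 2 := by nlinarith [Real.pi_gt_three]
    nlinarith

theorem hasDerivAt_thetaPrimitive {q : ℕ} [NeZero q] (a : ZMod q) (k : ℤ) (z : ℂ) :
    HasDerivAt (thetaPrimitive a k) (ZMod.stdAddChar (a * (k : ZMod q) ^ 2) *
      Complex.exp (-(4 * Real.pi ^ 2 * (k : ℂ) ^ 2 * z))) z := by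
  unfold thetaPrimitive
  refine HasDerivAt.const_mul _ ?_
  split_ifs with hk
  · simpa [hk] using hasDerivAt_id' z
  · have hne : -(4 * (Real.pi : ℂ) ^ 2 * (k : ℂ) ^ 2) ≠ 0 := by
      have : (Real.pi : ℂ) ≠ 0 := by exact_mod_cast Real.pi_ne_zero
      have : (k : ℂ) ≠ 0 := by exact_mod_cast hk
      simp [*]
    have h := ((((hasDerivAt_id z).const_mul
      (4 * (Real.pi : ℂ) ^ 2 * (k : ℂ) ^ 2)).neg.cexp).sub_const 1).div_const
        (-(4 * (Real.pi : ℂ) ^ 2 * (k : ℂ) ^ 2))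
    refine h.congr_deriv ?_
    simp only [id, mul_one, Pi.neg_apply]
    rw [mul_div_cancel_right₀ _ hne]

theorem norm_cpow_half (z : ℂ) : ‖z ^ (1 / 2 : ℂ)‖ = √‖z‖ := by
  rw [show (1 / 2 : ℂ) = ((1 / 2 : ℝ) : ℂ) by push_cast; ring, Complex.norm_cpow_real,
    Real.sqrt_eq_rpow]

theorem norm_dualPrimitive_le {q : ℕ} (n : ℤ) {z : ℂ} {R : ℝ}
    (hz : 0 < z.re) (hR : ‖z‖ ≤ R) :
    ‖dualPrimitive q n z‖ ≤
      (if n = 0 then 2 * √R else 0) + (4 * q ^ 2 * (R * √R)) * (1 / (n : ℝ) ^ 2) := by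
  have hz0 : z ≠ 0 := by rintro rfl; simp at hz
  have hs : √‖z‖ ≤ √R := Real.sqrt_le_sqrt hR
  rw [dualPrimitive]
  split_ifs with hn
  · rw [norm_mul, norm_cpow_half]
    simpa [hn] using hs
  · have hR0 : 0 ≤ R := (norm_nonneg z).trans hR
    rw [show (3 / 2 : ℂ) = 1 + 1 / 2 by norm_num, Complex.cpow_add _ _ hz0, Complex.cpow_one,
      norm_mul, norm_div, norm_mul, norm_cpow_half, Complex.norm_real,
      Real.norm_of_nonneg (by positivity), zero_add]
    calc ‖z‖ * √‖z‖ / ((n : ℝ) ^ 2 / (4 * q ^ 2)) *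
          ‖Complex.exp (-(((n : ℝ) ^ 2 / (4 * q ^ 2) : ℝ) / z))‖
        ≤ R * √R / ((n : ℝ) ^ 2 / (4 * q ^ 2)) * 1 := by
          gcongr
          exact norm_exp_neg_div_le_one (by positivity) hz
      _ = (4 * q ^ 2 * (R * √R)) * (1 / (n : ℝ) ^ 2) := by
          rw [mul_one, div_div_eq_mul_div]
          ring

/-- The derivative is the term of the dual theta series plus an error term, the summand. For
`n = 0` the error is `0`, the division by `0` giving `0`. -/
theorem hasDerivAt_dualPrimitive {q : ℕ} [NeZero q] (n : ℤ) {z : ℂ} (hz : 0 < z.re) :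
    HasDerivAt (dualPrimitive q n)
      ((z ^ (1 / 2 : ℂ))⁻¹ * Complex.exp (-(((n : ℝ) ^ 2 / (4 * q ^ 2) : ℝ) / z)) +
        3 / 2 * z ^ (1 / 2 : ℂ) / ((n : ℝ) ^ 2 / (4 * q ^ 2) : ℝ) *
          Complex.exp (-(((n : ℝ) ^ 2 / (4 * q ^ 2) : ℝ) / z))) z := by
  have hz0 : z ≠ 0 := by rintro rfl; simp at hz
  have hs0 : z ^ (1 / 2 : ℂ) ≠ 0 := by simp [Complex.cpow_eq_zero_iff, hz0]
  have hslit : z ∈ Complex.slitPlane := Or.inl hz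
  unfold dualPrimitive
  split_ifs with hn
  · have h := ((hasDerivAt_id z).cpow_const (c := (1 / 2 : ℂ)) hslit).const_mul 2
    refine h.congr_deriv ?_
    simp only [hn, id]
    rw [show (1 / 2 - 1 : ℂ) = -(1 / 2) by norm_num, Complex.cpow_neg]
    simp
  · set A : ℝ := (n : ℝ) ^ 2 / (4 * q ^ 2) with hA
    have hA0 : (A : ℂ) ≠ 0 := by
      have : (n : ℝ) ≠ 0 := by exact_mod_cast hn
      have : (q : ℝ) ≠ 0 := by exact_mod_cast NeZero.ne q
      rw [Complex.ofReal_ne_zero, hA]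
      positivity
    have h := (((hasDerivAt_id z).cpow_const (c := (3 / 2 : ℂ)) hslit).div_const (A : ℂ)).mul
      (((hasDerivAt_inv hz0).const_mul (A : ℂ)).neg.cexp)
    simp only [← div_eq_mul_inv, id] at h
    refine h.congr_deriv ?_
    simp only [Pi.neg_apply]
    have hsq : z ^ (1 / 2 : ℂ) * z ^ (1 / 2 : ℂ) = z := by
      rw [← Complex.cpow_add _ _ hz0]; norm_num
    rw [show (3 / 2 - 1 : ℂ) = 1 / 2 by norm_num,
      show (3 / 2 : ℂ) = 1 + 1 / 2 by norm_num, Complex.cpow_add _ _ hz0, Complex.cpow_one]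
    generalize z ^ (1 / 2 : ℂ) = s at *
    subst hsq
    field_simp
    ring

/-! ### Comparison of the two series -/

/-- The points of the open right half-plane of norm less than `R`. -/
def rightHalfBall (R : ℝ) : Set ℂ := {z | 0 < z.re} ∩ Metric.ball 0 R

theorem isOpen_rightHalfBall (R : ℝ) : IsOpen (rightHalfBall R) :=
  (isOpen_lt continuous_const Complex.continuous_re).inter Metric.isOpen_ball

theorem convex_rightHalfBall (R : ℝ) : Convex ℝ (rightHalfBall R) :=
  (convex_halfSpace_re_gt 0).inter (convex_ball 0 R)

/-- The series of the exact primitives minus the dual series of the approximate primitives, the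
latter with its Gauss sum coefficients. Its derivative is the sum of the error terms alone. -/
noncomputable def primitiveDefect {q : ℕ} [NeZero q] (a : ZMod q) (z : ℂ) : ℂ :=
  (∑' k : ℤ, thetaPrimitive a k z) - (2 * q * √Real.pi : ℝ)⁻¹ *
    ∑' n : ℤ, quadGaussSum a (-(n : ZMod q)) * dualPrimitive q n z

theorem norm_gauss_mul_dualPrimitive_le {q : ℕ} [NeZero q] {a : ZMod q} (ha : IsUnit a) (n : ℤ)
    {z : ℂ} {R : ℝ} (hz : 0 < z.re) (hR : ‖z‖ ≤ R) :
    ‖quadGaussSum a (-(n : ZMod q)) * dualPrimitive q n z‖ ≤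
      √(2 * q) * ((if n = 0 then 2 * √R else 0) +
        (4 * q ^ 2 * (R * √R)) * (1 / (n : ℝ) ^ 2)) := by
  rw [norm_mul]
  gcongr
  · exact norm_quadGaussSum_le ha _
  · exact norm_dualPrimitive_le n hz hR

theorem norm_tsum_dualPrimitive_le {q : ℕ} [NeZero q] {a : ZMod q} (ha : IsUnit a)
    {z : ℂ} {R : ℝ} (hz : 0 < z.re) (hR : ‖z‖ ≤ R) :
    ‖∑' n : ℤ, quadGaussSum a (-(n : ZMod q)) * dualPrimitive q n z‖ ≤
      √(2 * q) * (2 * √R + (4 * q ^ 2 * (R * √R)) * ∑' k : ℤ, 1 / (k : ℝ) ^ 2) := by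
  rw [← tsum_ite_add_mul_inv_sq, ← tsum_mul_left]
  exact tsum_of_norm_bounded ((summable_ite_add_mul_inv_sq _ _).mul_left _).hasSum
    fun n => norm_gauss_mul_dualPrimitive_le ha n hz hR

/-- By the transformation formula the main terms of the two derivatives agree. -/
theorem norm_deriv_primitiveDefect_le {q : ℕ} [NeZero q] {a : ZMod q} (ha : IsUnit a) {R : ℝ}
    {z : ℂ} (hz : z ∈ rightHalfBall R) :
    DifferentiableAt ℂ (primitiveDefect a) z ∧
    ‖deriv (primitiveDefect a) z‖ ≤ (2 * q * √Real.pi)⁻¹ *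
      (√(2 * q) * (6 * q ^ 2 * √R * ∑' k : ℤ, 1 / (k : ℝ) ^ 2)) := by
  have hU := isOpen_rightHalfBall R
  have hball : ∀ w ∈ rightHalfBall R, ‖w‖ ≤ R := fun w hw => (mem_ball_zero_iff.mp hw.2).le
  have hre : 0 < z.re := hz.1
  have hT1 : ∀ k : ℤ, ∀ w ∈ rightHalfBall R, ‖thetaPrimitive a k w‖ ≤
      (if k = 0 then R else 0) + 1 * (1 / (k : ℝ) ^ 2) :=
    fun k w hw => norm_thetaPrimitive_le a k (le_of_lt hw.1) (hball w hw)
  have hT2 : ∀ n : ℤ, ∀ w ∈ rightHalfBall R,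
      ‖quadGaussSum a (-(n : ZMod q)) * dualPrimitive q n w‖ ≤ _ :=
    fun n w hw => norm_gauss_mul_dualPrimitive_le ha n hw.1 (hball w hw)
  have hu1 := summable_ite_add_mul_inv_sq R 1
  have hu2 := (summable_ite_add_mul_inv_sq (2 * √R) (4 * q ^ 2 * (R * √R))).mul_left √(2 * q)
  have hD1 : ∀ k : ℤ, DifferentiableOn ℂ (thetaPrimitive a k) (rightHalfBall R) :=
    fun k w _ => (hasDerivAt_thetaPrimitive a k w).differentiableAt.differentiableWithinAt
  have hD2 : ∀ n : ℤ, DifferentiableOn ℂ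
      (fun w => quadGaussSum a (-(n : ZMod q)) * dualPrimitive q n w) (rightHalfBall R) :=
    fun n w hw =>
      ((hasDerivAt_dualPrimitive n hw.1).const_mul _).differentiableAt.differentiableWithinAt
  have hd1 : DifferentiableAt ℂ (fun w => ∑' k : ℤ, thetaPrimitive a k w) z :=
    (Complex.differentiableOn_tsum_of_summable_norm hu1 hD1 hU hT1).differentiableAt
      (hU.mem_nhds hz)
  have hd2 : DifferentiableAt ℂ
      (fun w => ∑' n : ℤ, quadGaussSum a (-(n : ZMod q)) * dualPrimitive q n w) z :=
    (Complex.differentiableOn_tsum_of_summable_norm hu2 hD2 hU hT2).differentiableAt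
      (hU.mem_nhds hz)
  have hS1 := Complex.hasSum_deriv_of_summable_norm hu1 hD1 hU hT1 hz
  have hS2 := Complex.hasSum_deriv_of_summable_norm hu2 hD2 hU hT2 hz
  simp only [(hasDerivAt_thetaPrimitive a _ z).deriv] at hS1
  simp only [((hasDerivAt_dualPrimitive (q := q) _ hre).const_mul _).deriv] at hS2
  refine ⟨hd1.sub (hd2.const_mul _), ?_⟩
  -- the sum of the error terms
  have hbd : ∀ n : ℤ, ‖quadGaussSum a (-(n : ZMod q)) * (3 / 2 * z ^ (1 / 2 : ℂ) /
      ((n : ℝ) ^ 2 / (4 * q ^ 2) : ℝ) *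
        Complex.exp (-(((n : ℝ) ^ 2 / (4 * q ^ 2) : ℝ) / z)))‖ ≤
      √(2 * q) * (6 * q ^ 2 * √R * (1 / (n : ℝ) ^ 2)) := by
    intro n
    have h32 : ‖(3 / 2 : ℂ)‖ = 3 / 2 := by norm_num
    rw [norm_mul, norm_mul, norm_div, norm_mul, norm_cpow_half, h32, Complex.norm_real,
      Real.norm_of_nonneg (by positivity)]
    calc _ ≤ √(2 * q) * (3 / 2 * √R / ((n : ℝ) ^ 2 / (4 * q ^ 2)) * 1) := by
          gcongr
          · exact norm_quadGaussSum_le ha _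
          · exact hball z hz
          · exact norm_exp_neg_div_le_one (by positivity) hre
      _ = _ := by
          rw [mul_one, div_div_eq_mul_div]
          ring
  have hsumR : Summable fun n : ℤ => √(2 * q) * (6 * q ^ 2 * √R * (1 / (n : ℝ) ^ 2)) :=
    ((Real.summable_one_div_int_pow.mpr one_lt_two).mul_left _).mul_left _
  have hSR := (Summable.of_norm_bounded hsumR hbd).hasSum
  have hmain := hS2.sub hSR
  have hcoef : ∑' n : ℤ, quadGaussSum a (-(n : ZMod q)) * ((z ^ (1 / 2 : ℂ))⁻¹ *
      Complex.exp (-(((n : ℝ) ^ 2 / (4 * q ^ 2) : ℝ) / z))) =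
      (z ^ (1 / 2 : ℂ))⁻¹ * ∑' n : ℤ, quadGaussSum a (-(n : ZMod q)) *
      Complex.exp (-(((n : ℝ) ^ 2 / (4 * q ^ 2) : ℝ) / z)) := by
    rw [← tsum_mul_left]
    exact tsum_congr fun n => by ring
  have hmain' := hmain.tsum_eq
  simp only [mul_add, add_sub_cancel_right] at hmain'
  rw [hcoef] at hmain'
  have hderiv : deriv (primitiveDefect a) z = -((2 * q * √Real.pi : ℝ)⁻¹ *
      ∑' n : ℤ, quadGaussSum a (-(n : ZMod q)) * (3 / 2 * z ^ (1 / 2 : ℂ) /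
      ((n : ℝ) ^ 2 / (4 * q ^ 2) : ℝ) *
        Complex.exp (-(((n : ℝ) ^ 2 / (4 * q ^ 2) : ℝ) / z)))) := by
    rw [show primitiveDefect a = fun w => (∑' k : ℤ, thetaPrimitive a k w) -
      (((2 * q * √Real.pi)⁻¹ : ℝ) : ℂ) *
        ∑' n : ℤ, quadGaussSum a (-(n : ZMod q)) * dualPrimitive q n w from rfl,
      deriv_fun_sub hd1 (hd2.const_mul _), deriv_const_mul _ hd2, ← hS1.tsum_eq,
      tsum_twisted_theta a hre, mul_assoc, hmain']
    ring
  rw [hderiv, norm_neg, norm_mul, Complex.norm_real,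
    Real.norm_of_nonneg (by positivity)]
  gcongr
  rw [← tsum_mul_left, ← tsum_mul_left]
  exact tsum_of_norm_bounded hsumR.hasSum hbd

/-- This follows from the mean value inequality for the defect, and from the size of the dual
series at both points. -/
theorem norm_tsum_thetaPrimitive_sub_le {q : ℕ} [NeZero q] {a : ZMod q} (ha : IsUnit a) {R : ℝ}
    {z w : ℂ} (hz : z ∈ rightHalfBall R) (hw : w ∈ rightHalfBall R) :
    ‖∑' k : ℤ, thetaPrimitive a k z - ∑' k : ℤ, thetaPrimitive a k w‖ ≤
      (2 * q * √Real.pi)⁻¹ * √(2 * q) *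
        (√R * (6 * q ^ 2 * ‖z - w‖ * ∑' k : ℤ, 1 / (k : ℝ) ^ 2) +
          2 * (2 * √R + (4 * q ^ 2 * (R * √R)) * ∑' k : ℤ, 1 / (k : ℝ) ^ 2)) := by
  set S : ℝ := ∑' k : ℤ, 1 / (k : ℝ) ^ 2
  have hmv := Convex.norm_image_sub_le_of_norm_deriv_le
    (fun x hx => (norm_deriv_primitiveDefect_le ha hx).1)
    (fun x hx => (norm_deriv_primitiveDefect_le ha hx).2) (convex_rightHalfBall R) hw hz
  have hWz := norm_tsum_dualPrimitive_le ha hz.1 (mem_ball_zero_iff.mp hz.2).le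
  have hWw := norm_tsum_dualPrimitive_le ha hw.1 (mem_ball_zero_iff.mp hw.2).le
  set Wz := ∑' n : ℤ, quadGaussSum a (-(n : ZMod q)) * dualPrimitive q n z
  set Ww := ∑' n : ℤ, quadGaussSum a (-(n : ZMod q)) * dualPrimitive q n w
  set c : ℝ := (2 * q * √Real.pi)⁻¹ with hc
  have hc0 : 0 ≤ c := by positivity
  -- exact series = defect + dual series, at each of the two points
  have hsplit : ∑' k : ℤ, thetaPrimitive a k z - ∑' k : ℤ, thetaPrimitive a k w =
      (primitiveDefect a z - primitiveDefect a w) + c * Wz - c * Ww := by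
    simp only [primitiveDefect, hc, Complex.ofReal_inv, Wz, Ww]
    ring
  have hcW : ∀ W : ℂ, ‖(c : ℂ) * W‖ = c * ‖W‖ := fun W => by
    rw [norm_mul, Complex.norm_real, Real.norm_of_nonneg hc0]
  rw [hsplit]
  refine (norm_sub_le _ _).trans ((add_le_add_left (norm_add_le _ _) _).trans ?_)
  rw [hcW, hcW]
  have h1 := mul_le_mul_of_nonneg_left hWz hc0
  have h2 := mul_le_mul_of_nonneg_left hWw hc0
  linarith

/-! ### The boundary of the half-plane -/

theorem continuousOn_tsum_thetaPrimitive {q : ℕ} [NeZero q] (a : ZMod q) (R : ℝ) :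
    ContinuousOn (fun z => ∑' k : ℤ, thetaPrimitive a k z)
      ({z | 0 ≤ z.re} ∩ Metric.closedBall 0 R) :=
  continuousOn_tsum
    (fun k z _ => (hasDerivAt_thetaPrimitive a k z).continuousAt.continuousWithinAt)
    (summable_ite_add_mul_inv_sq R 1)
    fun k _ hz => norm_thetaPrimitive_le a k hz.1 (mem_closedBall_zero_iff.mp hz.2)

theorem tsum_thetaPrimitive_zero {q : ℕ} [NeZero q] (a : ZMod q) :
    ∑' k : ℤ, thetaPrimitive a k 0 = 0 := by
  simp [thetaPrimitive]

/-- `2π t_{p,q} = p / q`, so the phases of `φ` at `t_{p,q}` are `e(-p k² / q)`. -/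
theorem riemannPhi_sub_eq (p q : ℕ) [NeZero q] (h : ℝ) :
    riemannPhi (ratPoint p q + h) - riemannPhi (ratPoint p q) =
      ∑' k : ℤ, thetaPrimitive (-(p : ZMod q)) k (Complex.I * h) := by
  rw [riemannPhi, riemannPhi, ← Summable.tsum_sub (summable_riemannTerm _) (summable_riemannTerm _)]
  refine tsum_congr fun k => ?_
  have hpi : (Real.pi : ℂ) ≠ 0 := by exact_mod_cast Real.pi_ne_zero
  have hq : (q : ℂ) ≠ 0 := by exact_mod_cast NeZero.ne q
  rw [thetaPrimitive, show -(p : ZMod q) * (k : ZMod q) ^ 2 = ((-p * k ^ 2 : ℤ) : ZMod q) by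
    push_cast; ring, ZMod.stdAddChar_coe]
  simp only [riemannTerm]
  split_ifs with hk
  · simp [hk]
    ring
  · rw [div_sub_div_same, ← mul_div_assoc, mul_sub, ← Complex.exp_add]
    congr 1
    · have h1 : -4 * (Real.pi : ℂ) ^ 2 * Complex.I * k ^ 2 * (ratPoint p q : ℝ) =
          2 * Real.pi * Complex.I * ((-p * k ^ 2 : ℤ) : ℂ) / q := by
        rw [ratPoint]
        push_cast
        field_simp
        ring
      have h2 : -4 * (Real.pi : ℂ) ^ 2 * Complex.I * k ^ 2 * ((ratPoint p q + h : ℝ) : ℂ) =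
          2 * Real.pi * Complex.I * ((-p * k ^ 2 : ℤ) : ℂ) / q +
            -(4 * Real.pi ^ 2 * (k : ℂ) ^ 2 * (Complex.I * h)) := by
        rw [← h1]
        push_cast
        ring
      rw [h1, h2]
      ring
    · ring

/-- The two endpoints `0` and `i h` lie on the boundary of the half-plane; they are approached as
`ε → 0⁺` by `ε` and `ε + i h`, which stay in the half-ball of radius `2 |h|`. -/
theorem norm_tsum_thetaPrimitive_I_mul_le {q : ℕ} [NeZero q] {a : ZMod q} (ha : IsUnit a)
    {h : ℝ} (hh : h ≠ 0) :
    ‖∑' k : ℤ, thetaPrimitive a k (Complex.I * h)‖ ≤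
      (2 * q * √Real.pi)⁻¹ * √(2 * q) * √(2 * |h|) *
        (4 + 22 * (q ^ 2 * |h|) * ∑' k : ℤ, 1 / (k : ℝ) ^ 2) := by
  have habs : 0 < |h| := abs_pos.mpr hh
  have hlim : ∀ w : ℂ, w.re = 0 → ‖w‖ ≤ |h| →
      Filter.Tendsto (fun ε : ℝ => ∑' k : ℤ, thetaPrimitive a k (ε + w)) (nhdsWithin 0 (Set.Ioi 0))
        (nhds (∑' k : ℤ, thetaPrimitive a k w)) := by
    intro w hw0 hw1
    have hmem : w ∈ {z : ℂ | 0 ≤ z.re} ∩ Metric.closedBall 0 (2 * |h|) :=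
      ⟨hw0.ge, mem_closedBall_zero_iff.mpr (by linarith)⟩
    refine (continuousOn_tsum_thetaPrimitive a (2 * |h|) w hmem).tendsto.comp ?_
    refine tendsto_nhdsWithin_iff.mpr ⟨?_, ?_⟩
    · have hc : Continuous fun ε : ℝ => (ε : ℂ) + w := by fun_prop
      simpa using (hc.tendsto 0).mono_left nhdsWithin_le_nhds
    · filter_upwards [Ioo_mem_nhdsGT habs] with ε hε
      refine ⟨by simp [hw0, hε.1.le], mem_closedBall_zero_iff.mpr ?_⟩
      refine (norm_add_le _ _).trans ?_
      rw [Complex.norm_real, Real.norm_of_nonneg hε.1.le]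
      linarith [hε.2]
  have hnorm : ‖Complex.I * (h : ℂ)‖ = |h| := by simp
  have h1 := (hlim (Complex.I * h) (by simp) hnorm.le).sub (hlim 0 (by simp) (by simp))
  rw [tsum_thetaPrimitive_zero, sub_zero] at h1
  refine le_of_tendsto h1.norm ?_
  filter_upwards [Ioo_mem_nhdsGT habs] with ε hε
  have hεn : ‖(ε : ℂ)‖ = ε := by rw [Complex.norm_real, Real.norm_of_nonneg hε.1.le]
  have hmem : ∀ w : ℂ, w.re = 0 → ‖w‖ ≤ |h| → (ε : ℂ) + w ∈ rightHalfBall (2 * |h|) := by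
    intro w hw0 hw1
    refine ⟨by simp [hw0, hε.1], mem_ball_zero_iff.mpr ?_⟩
    refine (norm_add_le _ _).trans_lt ?_
    linarith [hε.2]
  refine (norm_tsum_thetaPrimitive_sub_le ha (hmem (Complex.I * h) (by simp) hnorm.le)
    (hmem 0 (by simp) (by simp))).trans (le_of_eq ?_)
  rw [add_sub_add_left_eq_sub, sub_zero, hnorm]
  ring

theorem mainTheorem3 (M : ℝ) (hM : 0 < M) :
    ∃ C : ℝ, 0 < C ∧ ∀ p q : ℕ, 0 < q → Nat.Coprime p q →
      (q ≡ 0 [MOD 4] ∨ q ≡ 1 [MOD 4] ∨ q ≡ 3 [MOD 4]) →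
      ∀ h : ℝ, |h| < M / (q : ℝ) ^ 2 →
        ‖riemannPhi (ratPoint p q + h) - riemannPhi (ratPoint p q)‖ ≤
          C * (|h| ^ (1 / 2 : ℝ) / (q : ℝ) ^ (1 / 2 : ℝ)) := by
  set S : ℝ := ∑' k : ℤ, 1 / (k : ℝ) ^ 2 with hS
  have hS0 : 0 ≤ S := tsum_nonneg fun k => by positivity
  refine ⟨4 + 22 * M * S, by positivity, fun p q hq hpq _ h hh => ?_⟩
  have : NeZero q := ⟨hq.ne'⟩
  have hqr : (0 : ℝ) < q := by exact_mod_cast hq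
  rcases eq_or_ne h 0 with rfl | h0
  · simp only [add_zero, sub_self, norm_zero]
    positivity
  have ha : IsUnit (-(p : ZMod q)) := ((ZMod.isUnit_iff_coprime p q).mpr hpq).neg
  rw [riemannPhi_sub_eq, ← Real.sqrt_eq_rpow, ← Real.sqrt_eq_rpow]
  refine (norm_tsum_thetaPrimitive_I_mul_le ha h0).trans ?_
  have hqh : (q : ℝ) ^ 2 * |h| ≤ M := by
    rw [lt_div_iff₀ (by positivity)] at hh
    linarith
  have hconst : (2 * q * √Real.pi)⁻¹ * √(2 * q) * √(2 * |h|) ≤ √|h| / √q := by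
    have hpi1 : 1 ≤ √Real.pi := Real.one_le_sqrt.mpr (by linarith [Real.pi_gt_three])
    have hsq : √(2 * q) * √(2 * |h|) = 2 * √q * √|h| := by
      rw [Real.sqrt_mul zero_le_two, Real.sqrt_mul zero_le_two]
      linear_combination √q * √|h| * Real.mul_self_sqrt zero_le_two
    have hs0 : 0 < √(q : ℝ) := Real.sqrt_pos.mpr hqr
    have hqq := Real.mul_self_sqrt hqr.le
    rw [mul_assoc, hsq, inv_mul_eq_div, div_le_div_iff₀ (by positivity) hs0]
    calc 2 * √q * √|h| * √q = √|h| * (2 * q * 1) := by linear_combination 2 * √|h| * hqq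
      _ ≤ √|h| * (2 * q * √Real.pi) := by gcongr
  rw [mul_comm (4 + 22 * M * S), ← hS]
  gcongr
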